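/- **Theorem (Mean Value Theorem).** Let $n\ge 0$, let $\mathrm{Cl}_{0,n}$ be the real Clifford algebra with generators $e_1,\dots,e_n$, $e_ie_j+e_je_i=-2\delta_{ij}$, and let $V$ be a finite-dimensional real normed space that is a left $\mathrm{Cl}_{0,n}$-module (for example $V=\mathrm{Cl}_{0,n}$). Write points of $\mathbb R^{n+1}$ as $y=(y_0,y_1,\dots,y_n)$ and put $D=\frac{\partial}{\partial y_0}-\sum_{j=1}^n e_j\frac{\partial}{\partial y_j}$. Let $\Omega\subseteq\mathbb R^{n+1}$ be open, and let $\mathbb B(x,R)\subseteq\Omega$ be an open Euclidean ball, $R>0$. For an operator $M$, let $\mathcal M_M(\Omega)$ be the set of functions $f:\overline\Omega\to V$ that are continuous on $\overline\Omega$, continuously differentiable in $\Omega$, and satisfy $$\frac{\partial f}{\partial y_0}=\Big(\sum_{j=1}^n e_j\frac{\partial}{\partial y_j}+M\Big)f\quad\text{in }\Omega .$$ Let $$c_n=\frac{(n+1)\,\Gamma\!\left(\frac{n+1}{2}\right)}{2\,\pi^{(n+1)/2}} .$$ (a) Let $M:V\to V$ be a linear operator commuting with the action of every $e_j$, acting on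 functions by $(Mf)(y)=M(f(y))$. Then for every $f\in\mathcal M_M(\Omega)$ the function $y\mapsto e^{-y_0M}f(y)$ is integrable on $\mathbb B(x,R)$ and $$f(x)=e^{x_0M}\,\frac{c_n}{R^{n+1}}\int_{\mathbb B(x,R)}e^{-y_0M}f(y)\,dy .$$ (b) Likewise, let $M$ be a bounded operator on a real Banach space $X$ of continuous functions $\overline\Omega\to V$ with continuous point evaluations, and let $M$ commute with $D$ in the following sense: if $u,v\in X$, $u$ is continuously differentiable in $\Omega$ and $Du=v$ in $\Omega$, then $Mu$ is continuously differentiable in $\Omega$ and $D(Mu)=Mv$ in $\Omega$. Then for every $f\in X\cap\mathcal M_M(\Omega)$ the function $y\mapsto\big(e^{(x_0-y_0)M}f\big)(y)$ is integrable on $\mathbb B(x,R)$ and $$f(x)=\frac{c_n}{R^{n+1}}\int_{\mathbb B(x,R)}\big(e^{x_0M}e^{-y_0M}f\big)(y)\,dy .$$ Here, for each real $t$, $e^{tM}=\sum_{k\ge0}t^kM^k/k!$ is a bounded operator (on $V$ in (a), on $X$ in (b)). -/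

import Mathlib

open MeasureTheory

/-- The negative definite quadratic form `v ↦ -(v₁² + ⋯ + vₙ²)` on `ℝⁿ`. -/
noncomputable def negSumSq (n : ℕ) : QuadraticForm ℝ (Fin n → ℝ) :=
  QuadraticMap.weightedSumSquares ℝ (fun _ : Fin n => (-1 : ℝ))

/-- The real Clifford algebra `Cl(0,n)`. -/
abbrev Cliff (n : ℕ) : Type := CliffordAlgebra (negSumSq n)

/-- The generator `e_{j+1}` of `Cl(0,n)` (the index `j : Fin n` starts at `0`). -/
noncomputable def cliffGen {n : ℕ} (j : Fin n) : Cliff n :=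
  CliffordAlgebra.ι (negSumSq n) (Pi.single j 1)

/-- The anti-commutation relations of the generators. -/
theorem cliffGen_anticomm {n : ℕ} (i j : Fin n) :
    cliffGen i * cliffGen j + cliffGen j * cliffGen i =
      algebraMap ℝ (Cliff n) (if i = j then -2 else 0) := by
  unfold cliffGen
  rw [CliffordAlgebra.ι_mul_ι_add_swap]
  congr 1
  simp only [QuadraticMap.polar, negSumSq, QuadraticMap.weightedSumSquares_apply, Pi.add_apply,
    smul_eq_mul, ← Finset.sum_sub_distrib]
  rw [Finset.sum_congr rfl (g := fun k => if k = i then (if i = j then (-2 : ℝ) else 0) else 0)]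
  · simp
  · intro k _
    by_cases hi : k = i <;> by_cases hj : k = j <;> by_cases hij : i = j <;>
      simp_all; norm_num

/-- The Euclidean space of the points `y = (y₀, y₁, …, yₙ)`. -/
abbrev Pts (n : ℕ) : Type := EuclideanSpace ℝ (Fin (n + 1))

section Operators

variable {n : ℕ} {V : Type*} [NormedAddCommGroup V] [NormedSpace ℝ V] [Module (Cliff n) V]

/-- The partial derivative `∂f/∂y_j`, for `j = 0, …, n`. -/
noncomputable def partialD (j : Fin (n + 1)) (f : Pts n → V) (y : Pts n) : V :=
  fderiv ℝ f y (EuclideanSpace.single j 1)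

/-- The operator `∑_{j=1}^n e_j ∂/∂y_j`. -/
noncomputable def vectorD (f : Pts n → V) (y : Pts n) : V :=
  ∑ j : Fin n, (cliffGen j : Cliff n) • partialD j.succ f y

/-- The generalized Cauchy-Riemann operator `D = ∂/∂y₀ - ∑_{j=1}^n e_j ∂/∂y_j`. -/
noncomputable def cauchyRiemann (f : Pts n → V) (y : Pts n) : V :=
  partialD 0 f y - vectorD f y

/-- `f` is a classical solution in `Ω` of `∂f/∂y₀ = (∑ e_j ∂/∂y_j + M) f`, continuous on the
closure of `Ω`; the argument `Mf` is the function `M f`. -/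
structure IsMassSolution (Ω : Set (Pts n)) (f Mf : Pts n → V) : Prop where
  contDiffOn : ContDiffOn ℝ 1 f Ω
  continuousOn_closure : ContinuousOn f (closure Ω)
  equation : ∀ y ∈ Ω, partialD 0 f y = vectorD f y + Mf y

/-- The class `𝓜_M(Ω)` for an operator `M` that acts on the values of functions. -/
def massSolutions (Ω : Set (Pts n)) (M : V →L[ℝ] V) : Set (Pts n → V) :=
  {f | IsMassSolution Ω f (fun y => M (f y))}

/-- Via `ι`, the normed space `X` is a space of `V`-valued continuous functions on the closure of
`Ω`, with continuous point evaluations (the values of `ι u` off the closure are irrelevant). -/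
structure IsFunctionSpace (Ω : Set (Pts n)) {X : Type*} [NormedAddCommGroup X] [NormedSpace ℝ X]
    (ι : X →ₗ[ℝ] (Pts n → V)) : Prop where
  continuousOn : ∀ u : X, ContinuousOn (ι u) (closure Ω)
  continuous_eval : ∀ y ∈ closure Ω, Continuous fun u : X => ι u y
  injective : ∀ u : X, (∀ y ∈ closure Ω, ι u y = 0) → u = 0

/-- The operator `M` on the function space `X` commutes with `D`: if `u ∈ X` is continuously
differentiable in `Ω` and `D u = v ∈ X`, then `M u` is continuously differentiable in `Ω` and
`D (M u) = M v`. -/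
def CommutesWithCR (Ω : Set (Pts n)) {X : Type*} [NormedAddCommGroup X] [NormedSpace ℝ X]
    (ι : X →ₗ[ℝ] (Pts n → V)) (M : X →L[ℝ] X) : Prop :=
  ∀ u v : X, ContDiffOn ℝ 1 (ι u) Ω → (∀ y ∈ Ω, cauchyRiemann (ι u) y = ι v y) →
    ContDiffOn ℝ 1 (ι (M u)) Ω ∧ ∀ y ∈ Ω, cauchyRiemann (ι (M u)) y = ι (M v) y

end Operators

/-- The constant `(n+1) Γ((n+1)/2) / (2 π^((n+1)/2))`. -/
noncomputable def meanConst (n : ℕ) : ℝ :=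
  ((n : ℝ) + 1) * Real.Gamma (((n : ℝ) + 1) / 2) / (2 * Real.pi ^ (((n : ℝ) + 1) / 2))

/-! The integral of `g (x + r • y)` over the unit ball has `r`-derivative `∑ a, I a a`, where `I a
b` is the integral of `y a` times the `b`-th partial derivative of `g` at `x + r • y`. Rotation
invariance of the ball makes `I` symmetric (`setIntegral_ball_fderiv_swap`). For a symmetric array
the Clifford relations turn the trace into the integral of `(y₀ + ∑ e_i y_i) D g`
(`sum_diag_eq_cliffGen_contraction`). Only first derivatives of `g` enter, and no boundary integral.
Integrating in `r` bounds the defect of the mean value property by a constant times `sup ‖D g‖`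
(`exists_norm_mean_sub_le`).

In (a), `g = e^{-y₀M} f` satisfies `D g = 0`, so the defect vanishes. In (b), differentiability of
the full exponential series is not at hand, so the estimate is applied to its partial sums: `D`
telescopes them to one term, which tends to zero uniformly on the ball, and dominated convergence
gives the formula. -/

theorem add_clm_apply_mem_closedBall {E : Type*} [NormedAddCommGroup E] [NormedSpace ℝ E]
    {x y : E} {A : E →L[ℝ] E} {r : ℝ} (hA : ‖A‖ ≤ r)
    (hy : y ∈ Metric.closedBall (0 : E) 1) : x + A y ∈ Metric.closedBall x r := by
  have hy : ‖y‖ ≤ 1 := by simpa using hy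
  have : ‖A y‖ ≤ r := (A.le_opNorm y).trans <|
    (mul_le_of_le_one_right (norm_nonneg _) hy).trans hA
  simpa using this

/-! ### Integrals over the unit ball and their invariance under rotations. -/

section BallIntegrals

variable {E W : Type*} [NormedAddCommGroup E] [InnerProductSpace ℝ E] [FiniteDimensional ℝ E]
  [MeasurableSpace E] [BorelSpace E] [NormedAddCommGroup W]

theorem integrableOn_ball_of_continuousOn_closedBall {g : E → W} {x : E} {R : ℝ}
    (hg : ContinuousOn g (Metric.closedBall x R)) : IntegrableOn g (Metric.ball x R) :=
  (hg.integrableOn_compact (isCompact_closedBall x R)).mono_set Metric.ball_subset_closedBall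

variable [NormedSpace ℝ W]

/-- Differentiation under the integral sign of the mean of a `C¹` function over the images of the
unit ball under a differentiable family of linear maps. -/
theorem hasDerivAt_setIntegral_ball_comp {g : E → W} {x : E} {R : ℝ}
    (hg : ContDiffOn ℝ 1 g (Metric.ball x R)) {T T' : ℝ → E →L[ℝ] E}
    (hT : ∀ s, HasDerivAt T (T' s) s) (hT' : Continuous T') {s : ℝ} (hs : ‖T s‖ < R) :
    HasDerivAt (fun t => ∫ y in Metric.ball (0 : E) 1, g (x + T t y))
      (∫ y in Metric.ball (0 : E) 1, fderiv ℝ g (x + T s y) (T' s y)) s := by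
  obtain ⟨r, hsr, hrR⟩ := exists_between hs
  have hTc : Continuous T := continuous_iff_continuousAt.2 fun t => (hT t).continuousAt
  have hsub : Metric.closedBall x r ⊆ Metric.ball x R := Metric.closedBall_subset_ball hrR
  have hdc : ContinuousOn (fderiv ℝ g) (Metric.ball x R) :=
    hg.continuousOn_fderiv_of_isOpen Metric.isOpen_ball le_rfl
  obtain ⟨K, hK⟩ := (isCompact_closedBall x r).exists_bound_of_continuousOn (hdc.mono hsub)
  -- On `U` the points `x + T t y` stay in a compact ball where the derivative of `g` is at most
  -- `K`, so a constant dominates.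
  set U : Set ℝ := {t | ‖T t‖ < r ∧ ‖T' t‖ < ‖T' s‖ + 1}
  have hU : U ∈ nhds s := (((isOpen_lt hTc.norm continuous_const).inter
    (isOpen_lt hT'.norm continuous_const)).mem_nhds ⟨hsr, lt_add_one ‖T' s‖⟩)
  have hmem : ∀ t ∈ U, ∀ y ∈ Metric.closedBall (0 : E) 1, x + T t y ∈ Metric.closedBall x r :=
    fun t ht y hy => add_clm_apply_mem_closedBall ht.1.le hy
  have hcont : ∀ t ∈ U, ContinuousOn (fun y => g (x + T t y)) (Metric.closedBall 0 1) :=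
    fun t ht => hg.continuousOn.comp (by fun_prop) fun y hy => hsub (hmem t ht y hy)
  have hsU : s ∈ U := mem_of_mem_nhds hU
  refine (hasDerivAt_integral_of_dominated_loc_of_deriv_le
    (F' := fun t y => fderiv ℝ g (x + T t y) (T' t y))
    (bound := fun _ => K * (‖T' s‖ + 1)) hU ?_ ?_ ?_ ?_ ?_ ?_).2
  · filter_upwards [hU] with t ht
    exact (integrableOn_ball_of_continuousOn_closedBall (hcont t ht)).aestronglyMeasurable
  · exact integrableOn_ball_of_continuousOn_closedBall (hcont s hsU)
  · refine (integrableOn_ball_of_continuousOn_closedBall ?_).aestronglyMeasurable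
    exact (hdc.comp (by fun_prop) fun y hy => hsub (hmem s hsU y hy)).clm_apply (by fun_prop)
  · refine ae_restrict_of_forall_mem measurableSet_ball fun y hy t ht => ?_
    have hy1 : ‖y‖ ≤ 1 := by simpa using (Metric.ball_subset_closedBall hy)
    have h1 := hK _ (hmem t ht y (Metric.ball_subset_closedBall hy))
    have h2 : ‖T' t y‖ ≤ ‖T' s‖ + 1 := ((T' t).le_opNorm y).trans <|
      (mul_le_of_le_one_right (norm_nonneg _) hy1).trans ht.2.le
    exact (ContinuousLinearMap.le_opNorm _ _).trans
      (mul_le_mul h1 h2 (norm_nonneg _) ((norm_nonneg _).trans h1))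
  · exact integrableOn_const (measure_ball_lt_top.ne)
  · refine ae_restrict_of_forall_mem measurableSet_ball fun y hy t ht => ?_
    have hd : HasFDerivAt g (fderiv ℝ g (x + T t y)) (x + T t y) :=
      ((hg.differentiableOn one_ne_zero).differentiableAt (Metric.isOpen_ball.mem_nhds
        (hsub (hmem t ht y (Metric.ball_subset_closedBall hy))))).hasFDerivAt
    have hl : HasDerivAt (fun t => x + T t y) (T' t y) t := by
      simpa using ((hT t).clm_apply (hasDerivAt_const t y)).const_add x
    exact hd.comp_hasDerivAt t hl

theorem setIntegral_ball_linearIsometryEquiv_comp (e : E ≃ₗᵢ[ℝ] E) (h : E → W) (r : ℝ) :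
    ∫ y in Metric.ball (0 : E) r, h (e y) = ∫ y in Metric.ball (0 : E) r, h y := by
  have := e.measurePreserving.setIntegral_preimage_emb
    e.toHomeomorph.measurableEmbedding h (Metric.ball 0 r)
  rwa [LinearIsometryEquiv.preimage_ball, map_zero] at this

/-- The integral over a ball of the derivative along an infinitesimal rotation vanishes. -/
theorem setIntegral_ball_fderiv_skewAdjoint {g : E → W} {x : E} {R r : ℝ}
    (hg : ContDiffOn ℝ 1 g (Metric.ball x R)) (hr : 0 < r) (hrR : r < R) {A : E →L[ℝ] E}
    (hA : A ∈ skewAdjoint (E →L[ℝ] E)) :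
    ∫ y in Metric.ball (0 : E) 1, fderiv ℝ g (x + r • y) (A y) = 0 := by
  -- The exponential of a skew-adjoint operator is unitary, so the integral along this family is
  -- constant in `s`; its derivative at `s = 0` is `r` times the integral in question.
  have hT : ∀ s : ℝ, HasDerivAt (fun s : ℝ => r • NormedSpace.exp (s • A))
      (r • (NormedSpace.exp (s • A) * A)) s := fun s =>
    (hasDerivAt_exp_smul_const (𝕂 := ℝ) A s).const_smul r
  have hexp : Continuous fun s : ℝ => NormedSpace.exp (s • A) :=
    continuous_iff_continuousAt.2 fun s => (hasDerivAt_exp_smul_const (𝕂 := ℝ) A s).continuousAt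
  have hu : ∀ s : ℝ, NormedSpace.exp (s • A) ∈ unitary (E →L[ℝ] E) := fun s => by
    let _ : NormedAlgebra ℚ (E →L[ℝ] E) := .restrictScalars ℚ ℝ _
    exact NormedSpace.exp_mem_unitary_of_mem_skewAdjoint (skewAdjoint.smul_mem s hA)
  have h0 : ‖r • NormedSpace.exp ((0 : ℝ) • A)‖ < R := by
    rw [zero_smul, NormedSpace.exp_zero, norm_smul, Real.norm_of_nonneg hr.le]
    exact (mul_le_of_le_one_right hr.le ContinuousLinearMap.norm_id_le).trans_lt hrR
  have hd := hasDerivAt_setIntegral_ball_comp hg hT (by fun_prop) h0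
  have hconst : (fun t : ℝ => ∫ y in Metric.ball (0 : E) 1,
      g (x + (r • NormedSpace.exp (t • A)) y)) =
      fun _ => ∫ y in Metric.ball (0 : E) 1, g (x + r • y) := by
    funext t
    exact setIntegral_ball_linearIsometryEquiv_comp
      (Unitary.linearIsometryEquiv ⟨_, hu t⟩) (fun z => g (x + r • z)) 1
  rw [hconst] at hd
  have h := hd.unique (hasDerivAt_const (0 : ℝ) _)
  simp only [zero_smul, NormedSpace.exp_zero, one_mul, smul_apply,
    one_apply_eq_self, map_smul] at h
  rw [integral_smul] at h
  exact (smul_eq_zero.1 h).resolve_left hr.ne'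

theorem integrableOn_ball_fderiv {n : ℕ} {g : Pts n → W} {x : Pts n} {R r : ℝ}
    (hg : ContDiffOn ℝ 1 g (Metric.ball x R)) (hr : 0 ≤ r) (hrR : r < R) (a : Fin (n + 1))
    (v : Pts n) :
    IntegrableOn (fun y : Pts n => y a • fderiv ℝ g (x + r • y) v) (Metric.ball 0 1) := by
  refine integrableOn_ball_of_continuousOn_closedBall ?_
  have hdc : ContinuousOn (fderiv ℝ g) (Metric.ball x R) :=
    hg.continuousOn_fderiv_of_isOpen Metric.isOpen_ball le_rfl
  have hA : ‖r • ContinuousLinearMap.id ℝ (Pts n)‖ ≤ r := by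
    rw [norm_smul, Real.norm_of_nonneg hr]
    exact mul_le_of_le_one_right hr ContinuousLinearMap.norm_id_le
  refine ContinuousOn.smul (by fun_prop) (ContinuousOn.clm_apply ?_ continuousOn_const)
  exact hdc.comp (by fun_prop) fun y hy =>
    Metric.closedBall_subset_ball hrR (add_clm_apply_mem_closedBall hA hy)

theorem setIntegral_ball_fderiv_swap {n : ℕ} {g : Pts n → W} {x : Pts n} {R r : ℝ}
    (hg : ContDiffOn ℝ 1 g (Metric.ball x R)) (hr : 0 < r) (hrR : r < R) (a b : Fin (n + 1)) :
    ∫ y in Metric.ball (0 : Pts n) 1,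
      y a • fderiv ℝ g (x + r • y) (EuclideanSpace.single b 1) =
    ∫ y in Metric.ball (0 : Pts n) 1,
      y b • fderiv ℝ g (x + r • y) (EuclideanSpace.single a 1) := by
  -- Generator of the rotations in the plane of the coordinates `a` and `b`: `A y = y_a e_b - y_b
  -- e_a`.
  set A : Pts n →L[ℝ] Pts n :=
    (EuclideanSpace.proj a : Pts n →L[ℝ] ℝ).smulRight (EuclideanSpace.single b 1) -
      (EuclideanSpace.proj b : Pts n →L[ℝ] ℝ).smulRight (EuclideanSpace.single a 1) with hAdef
  have hA : A ∈ skewAdjoint (Pts n →L[ℝ] Pts n) := by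
    rw [skewAdjoint.mem_iff, ContinuousLinearMap.star_eq_adjoint, eq_comm,
      ContinuousLinearMap.eq_adjoint_iff]
    intro u v
    simp [hAdef, inner_sub_left, inner_sub_right, inner_smul_left, inner_smul_right,
      EuclideanSpace.inner_single_left, EuclideanSpace.inner_single_right]
    ring
  have h := setIntegral_ball_fderiv_skewAdjoint hg hr hrR hA
  rw [← sub_eq_zero, ← integral_sub (integrableOn_ball_fderiv hg hr.le hrR a _)
    (integrableOn_ball_fderiv hg hr.le hrR b _), ← h]
  simp [hAdef]

end BallIntegrals

/-! ### Clifford contraction and the approximate mean value property. -/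

section CliffordAction

theorem cauchyRiemann_eq {n : ℕ} {V : Type*} [NormedAddCommGroup V] [NormedSpace ℝ V]
    [Module (Cliff n) V] (f : Pts n → V) (y : Pts n) :
    cauchyRiemann f y = fderiv ℝ f y (EuclideanSpace.single 0 1) -
      ∑ j : Fin n, (cliffGen j : Cliff n) • fderiv ℝ f y (EuclideanSpace.single j.succ 1) := rfl

variable {n : ℕ} {V : Type*} [NormedAddCommGroup V] [NormedSpace ℝ V]
  [Module (Cliff n) V] [IsScalarTower ℝ (Cliff n) V]

theorem cliffGen_smul_smul_add (i j : Fin n) (v : V) :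
    (cliffGen i : Cliff n) • (cliffGen j : Cliff n) • v +
      (cliffGen j : Cliff n) • (cliffGen i : Cliff n) • v =
      (if i = j then (-2 : ℝ) else 0) • v := by
  rw [smul_smul, smul_smul, ← add_smul, cliffGen_anticomm, algebraMap_smul]

/-- The trace of a symmetric array of vectors in terms of its Clifford contractions. -/
theorem sum_diag_eq_cliffGen_contraction (I : Fin (n + 1) → Fin (n + 1) → V)
    (hI : ∀ a b, I a b = I b a) :
    ∑ a, I a a = (I 0 0 - ∑ j : Fin n, (cliffGen j : Cliff n) • I 0 j.succ) +
      ∑ i : Fin n, (cliffGen i : Cliff n) •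
        (I i.succ 0 - ∑ j : Fin n, (cliffGen j : Cliff n) • I i.succ j.succ) := by
  -- Averaging the double sum with its transpose, which is allowed by the symmetry of `I`, produces
  -- anticommutators: only the diagonal survives.
  have hS : (2 : ℝ) • ∑ i : Fin n, ∑ j : Fin n,
      (cliffGen i : Cliff n) • (cliffGen j : Cliff n) • I i.succ j.succ =
      (-2 : ℝ) • ∑ i : Fin n, I i.succ i.succ := by
    rw [two_smul]
    nth_rw 2 [Finset.sum_comm]
    simp_rw [← Finset.sum_add_distrib, Finset.smul_sum]
    refine Finset.sum_congr rfl fun i _ => ?_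
    rw [Finset.sum_eq_single i]
    · rw [cliffGen_smul_smul_add]; simp
    · intro j _ hj
      rw [hI j.succ i.succ, cliffGen_smul_smul_add, if_neg hj.symm, zero_smul]
    · simp
  have hS' : ∑ i : Fin n, ∑ j : Fin n,
      (cliffGen i : Cliff n) • (cliffGen j : Cliff n) • I i.succ j.succ =
      - ∑ i : Fin n, I i.succ i.succ := by
    refine smul_right_injective V (two_ne_zero' ℝ) ?_
    simpa using hS
  simp_rw [smul_sub, Finset.smul_sum, Finset.sum_sub_distrib, hS', Fin.sum_univ_succ,
    fun i : Fin n => hI i.succ 0]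
  abel

variable [FiniteDimensional ℝ V]

/-- The action of an element of the Clifford algebra as a bounded operator. -/
noncomputable def cliffAction (V : Type*) [NormedAddCommGroup V] [NormedSpace ℝ V]
    [Module (Cliff n) V] [IsScalarTower ℝ (Cliff n) V] [FiniteDimensional ℝ V] (c : Cliff n) :
    V →L[ℝ] V :=
  LinearMap.toContinuousLinearMap (Algebra.lsmul ℝ ℝ V c)

@[simp]
theorem cliffAction_apply (c : Cliff n) (v : V) : cliffAction V c v = c • v := rfl

theorem setIntegral_ball_smul_cauchyRiemann {g : Pts n → V} {x : Pts n} {R r : ℝ}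
    (hg : ContDiffOn ℝ 1 g (Metric.ball x R)) (hr : 0 ≤ r) (hrR : r < R) (a : Fin (n + 1)) :
    ∫ y in Metric.ball (0 : Pts n) 1, y a • cauchyRiemann g (x + r • y) =
      (∫ y in Metric.ball (0 : Pts n) 1,
        y a • fderiv ℝ g (x + r • y) (EuclideanSpace.single 0 1)) -
      ∑ j : Fin n, (cliffGen j : Cliff n) • ∫ y in Metric.ball (0 : Pts n) 1,
        y a • fderiv ℝ g (x + r • y) (EuclideanSpace.single j.succ 1) := by
  have hint := fun v => integrableOn_ball_fderiv hg hr hrR a v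
  have hc : ∀ (j : Fin n), (cliffGen j : Cliff n) • (∫ y in Metric.ball (0 : Pts n) 1,
        y a • fderiv ℝ g (x + r • y) (EuclideanSpace.single j.succ 1)) =
      ∫ y in Metric.ball (0 : Pts n) 1, cliffAction V (cliffGen j)
        (y a • fderiv ℝ g (x + r • y) (EuclideanSpace.single j.succ 1)) := fun j =>
    ((cliffAction V (cliffGen j : Cliff n)).integral_comp_comm (hint _)).symm
  simp_rw [hc]
  rw [← integral_finsetSum _ fun j _ =>
      (cliffAction V (cliffGen j : Cliff n)).integrable_comp (hint _),
    ← integral_sub (hint _) (integrable_finsetSum _ fun j _ =>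
      (cliffAction V (cliffGen j : Cliff n)).integrable_comp (hint _))]
  refine integral_congr_ae (Filter.Eventually.of_forall fun y => ?_)
  simp only [cauchyRiemann_eq, smul_sub, Finset.smul_sum, map_smul, cliffAction_apply]

/-- The radial derivative of the mean over balls is controlled by the Cauchy-Riemann operator. -/
theorem norm_setIntegral_ball_fderiv_radial_le {g : Pts n → V} {x : Pts n} {R r ε : ℝ}
    (hg : ContDiffOn ℝ 1 g (Metric.ball x R)) (hr : 0 ≤ r) (hrR : r < R)
    (hε : ∀ y ∈ Metric.ball x R, ‖cauchyRiemann g y‖ ≤ ε) :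
    ‖∫ y in Metric.ball (0 : Pts n) 1, fderiv ℝ g (x + r • y) y‖ ≤
      (1 + ∑ j : Fin n, ‖cliffAction V (cliffGen j : Cliff n)‖) *
        (ε * volume.real (Metric.ball (0 : Pts n) 1)) := by
  have hb : ∀ a : Fin (n + 1), ‖∫ y in Metric.ball (0 : Pts n) 1,
      y a • cauchyRiemann g (x + r • y)‖ ≤ ε * volume.real (Metric.ball (0 : Pts n) 1) := by
    refine fun a => norm_setIntegral_le_of_norm_le_const measure_ball_lt_top fun y hy => ?_
    have hy1 : ‖y‖ < 1 := by simpa using hy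
    have hmem : x + r • y ∈ Metric.ball x R := by
      have : ‖r • y‖ < R := by
        rw [norm_smul, Real.norm_of_nonneg hr]
        exact (mul_le_of_le_one_right hr hy1.le).trans_lt hrR
      simpa using this
    have ha : ‖y a‖ ≤ 1 := (PiLp.norm_apply_le y a).trans hy1.le
    rw [norm_smul]
    exact (mul_le_of_le_one_left (norm_nonneg _) ha).trans (hε _ hmem)
  -- The rotation argument divides by `r`. At `r = 0` the integrand is linear in `y`, hence odd, and
  -- its integral vanishes.
  rcases hr.eq_or_lt with rfl | hr0
  · have hneg := setIntegral_ball_linearIsometryEquiv_comp (LinearIsometryEquiv.neg ℝ)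
      (fun y : Pts n => fderiv ℝ g x y) 1
    simp only [LinearIsometryEquiv.coe_neg, map_neg, integral_neg] at hneg
    have h0 : ∫ y in Metric.ball (0 : Pts n) 1, fderiv ℝ g x y = 0 := by
      refine smul_right_injective V (two_ne_zero' ℝ) ?_
      simp only [two_smul, add_zero]
      nth_rw 1 [← hneg]
      exact neg_add_cancel _
    simp only [zero_smul, add_zero, h0, norm_zero]
    exact mul_nonneg (by positivity) ((norm_nonneg _).trans (hb 0))
  · have hsum : ∫ y in Metric.ball (0 : Pts n) 1, fderiv ℝ g (x + r • y) y =
        ∑ a : Fin (n + 1), ∫ y in Metric.ball (0 : Pts n) 1,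
          y a • fderiv ℝ g (x + r • y) (EuclideanSpace.single a 1) := by
      rw [← integral_finsetSum _ fun a _ => integrableOn_ball_fderiv hg hr hrR a _]
      refine integral_congr_ae (Filter.Eventually.of_forall fun y => ?_)
      simp only [← map_smul, ← map_sum]
      congr 1
      have := ((EuclideanSpace.basisFun (Fin (n + 1)) ℝ).sum_repr y).symm
      simpa using this
    rw [hsum, sum_diag_eq_cliffGen_contraction (fun a b => ∫ y in Metric.ball (0 : Pts n) 1,
      y a • fderiv ℝ g (x + r • y) (EuclideanSpace.single b 1))
      fun a b => setIntegral_ball_fderiv_swap hg hr0 hrR a b]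
    simp only [← setIntegral_ball_smul_cauchyRiemann hg hr hrR]
    rw [add_mul, one_mul, Finset.sum_mul]
    refine (norm_add_le _ _).trans (add_le_add (hb 0) ((norm_sum_le _ _).trans ?_))
    exact Finset.sum_le_sum fun j _ =>
      ((cliffAction V (cliffGen j : Cliff n)).le_opNorm _).trans
        (mul_le_mul_of_nonneg_left (hb _) (norm_nonneg _))

/-- Mean value inequality on `[0, R]` for the integral as a function of the radius. Since `g` is
`C¹` only in the open ball, the derivative is used on `[0, R)`, and continuity on the closed ball
reaches the endpoint. -/
theorem norm_setIntegral_ball_sub_le {g : Pts n → V} {x : Pts n} {R ε : ℝ} (hR : 0 < R)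
    (hgc : ContinuousOn g (Metric.closedBall x R)) (hg : ContDiffOn ℝ 1 g (Metric.ball x R))
    (hε : ∀ y ∈ Metric.ball x R, ‖cauchyRiemann g y‖ ≤ ε) :
    ‖(∫ y in Metric.ball (0 : Pts n) 1, g (x + R • y)) -
        volume.real (Metric.ball (0 : Pts n) 1) • g x‖ ≤
      (1 + ∑ j : Fin n, ‖cliffAction V (cliffGen j : Cliff n)‖) *
        (ε * volume.real (Metric.ball (0 : Pts n) 1)) * R := by
  have hmem : ∀ s ∈ Set.Icc 0 R, ∀ y ∈ Metric.closedBall (0 : Pts n) 1,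
      x + s • y ∈ Metric.closedBall x R := by
    intro s hs y hy
    have hA : ‖s • ContinuousLinearMap.id ℝ (Pts n)‖ ≤ R := by
      rw [norm_smul, Real.norm_of_nonneg hs.1]
      exact (mul_le_of_le_one_right hs.1 ContinuousLinearMap.norm_id_le).trans hs.2
    exact add_clm_apply_mem_closedBall hA hy
  have hcont : ContinuousOn (fun s : ℝ => ∫ y in Metric.ball (0 : Pts n) 1, g (x + s • y))
      (Set.Icc 0 R) := by
    obtain ⟨K, hK⟩ := (isCompact_closedBall x R).exists_bound_of_continuousOn hgc
    refine continuousOn_of_dominated (bound := fun _ => K) (fun s hs => ?_) (fun s hs => ?_)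
      (integrableOn_const measure_ball_lt_top.ne) ?_
    · exact (integrableOn_ball_of_continuousOn_closedBall
        (hgc.comp (by fun_prop) fun y hy => hmem s hs y hy)).aestronglyMeasurable
    · exact ae_restrict_of_forall_mem measurableSet_ball fun y hy =>
        hK _ (hmem s hs y (Metric.ball_subset_closedBall hy))
    · exact ae_restrict_of_forall_mem measurableSet_ball fun y hy =>
        hgc.comp (by fun_prop) fun s hs => hmem s hs y (Metric.ball_subset_closedBall hy)
  have hderiv : ∀ s ∈ Set.Ico 0 R, HasDerivWithinAt
      (fun s : ℝ => ∫ y in Metric.ball (0 : Pts n) 1, g (x + s • y))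
      (∫ y in Metric.ball (0 : Pts n) 1, fderiv ℝ g (x + s • y) y) (Set.Ici s) s := by
    intro s hs
    have hT : ∀ t : ℝ, HasDerivAt (fun t : ℝ => t • ContinuousLinearMap.id ℝ (Pts n))
        (ContinuousLinearMap.id ℝ (Pts n)) t := fun t => by
      simpa using (hasDerivAt_id t).smul_const (ContinuousLinearMap.id ℝ (Pts n))
    have hlt : ‖s • ContinuousLinearMap.id ℝ (Pts n)‖ < R := by
      rw [norm_smul, Real.norm_of_nonneg hs.1]
      exact (mul_le_of_le_one_right hs.1 ContinuousLinearMap.norm_id_le).trans_lt hs.2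
    exact (hasDerivAt_setIntegral_ball_comp hg hT continuous_const hlt).hasDerivWithinAt
  have := norm_image_sub_le_of_norm_deriv_right_le_segment hcont hderiv
    (fun s hs => norm_setIntegral_ball_fderiv_radial_le hg hs.1 hs.2 hε) R ⟨hR.le, le_rfl⟩
  simpa using this

/-- The ball volume formula contains `Γ((n+1)/2 + 1)`; the functional equation of `Γ` matches it
with the constant. -/
theorem volume_real_ball_mul_meanConst (n : ℕ) :
    volume.real (Metric.ball (0 : Pts n) 1) * meanConst n = 1 := by
  have hG := Real.Gamma_add_one (s := ((n : ℝ) + 1) / 2) (by positivity)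
  have hGpos : 0 < Real.Gamma (((n : ℝ) + 1) / 2) := Real.Gamma_pos_of_pos (by positivity)
  have hpi : √Real.pi ^ (n + 1) = Real.pi ^ (((n : ℝ) + 1) / 2) := by
    rw [Real.sqrt_eq_rpow, ← Real.rpow_natCast, ← Real.rpow_mul Real.pi_pos.le]
    congr 1
    push_cast
    ring
  have hpos : 0 < Real.pi ^ (((n : ℝ) + 1) / 2) := Real.rpow_pos_of_pos Real.pi_pos _
  rw [Measure.real, EuclideanSpace.volume_ball, Fintype.card_fin, ENNReal.ofReal_one, one_pow,
    one_mul]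
  push_cast
  rw [hG, hpi, ENNReal.toReal_ofReal (by positivity), meanConst]
  field_simp

open scoped Pointwise in
theorem setIntegral_ball_comp_add_smul {V : Type*} [NormedAddCommGroup V] [NormedSpace ℝ V]
    (g : Pts n → V) (x : Pts n) {R : ℝ} (hR : 0 < R) :
    ∫ y in Metric.ball (0 : Pts n) 1, g (x + R • y) =
      (R ^ (n + 1))⁻¹ • ∫ y in Metric.ball x R, g y := by
  rw [Measure.setIntegral_comp_smul_of_pos volume (fun z => g (x + z)) _ hR]
  have h1 : R • Metric.ball (0 : Pts n) 1 = Metric.ball 0 R := by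
    rw [smul_ball hR.ne', smul_zero, Real.norm_of_nonneg hR.le, mul_one]
  have h2 := (measurePreserving_add_left volume x).setIntegral_preimage_emb
    (measurableEmbedding_addLeft x) g (Metric.ball x R)
  have h3 : (fun z => x + z) ⁻¹' Metric.ball x R = Metric.ball (0 : Pts n) R := by
    ext z; simp
  rw [h1, finrank_euclideanSpace_fin, ← h2, h3]

/-- The mean value property with an error controlled by the Cauchy-Riemann operator. -/
theorem exists_norm_mean_sub_le (V : Type*) [NormedAddCommGroup V] [NormedSpace ℝ V]
    [Module (Cliff n) V] [IsScalarTower ℝ (Cliff n) V] [FiniteDimensional ℝ V]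
    (x : Pts n) {R : ℝ} (hR : 0 < R) :
    ∃ C : ℝ, ∀ (g : Pts n → V) (ε : ℝ), ContinuousOn g (Metric.closedBall x R) →
      ContDiffOn ℝ 1 g (Metric.ball x R) →
      (∀ y ∈ Metric.ball x R, ‖cauchyRiemann g y‖ ≤ ε) →
      ‖(meanConst n / R ^ (n + 1)) • (∫ y in Metric.ball x R, g y) - g x‖ ≤ C * ε := by
  -- The constant does not depend on `g` or `ε`, so one `C` serves a whole sequence of functions.
  refine ⟨|meanConst n| * ((1 + ∑ j : Fin n, ‖cliffAction V (cliffGen j : Cliff n)‖) *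
    volume.real (Metric.ball (0 : Pts n) 1) * R), fun g ε hgc hg hε => ?_⟩
  have h := norm_setIntegral_ball_sub_le hR hgc hg hε
  rw [setIntegral_ball_comp_add_smul g x hR] at h
  have h1 := mul_le_mul_of_nonneg_left h (abs_nonneg (meanConst n))
  rw [← Real.norm_eq_abs, ← norm_smul, smul_sub, smul_smul, smul_smul, mul_comm (meanConst n)
    (volume.real _), volume_real_ball_mul_meanConst, one_smul, ← div_eq_mul_inv] at h1
  refine h1.trans_eq ?_
  rw [Real.norm_eq_abs]
  ring

end CliffordAction

/-! ### Product rules for the Cauchy-Riemann operator. -/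

section ProductRule

variable {n : ℕ} {V : Type*} [NormedAddCommGroup V] [NormedSpace ℝ V] [Module (Cliff n) V]

theorem contDiff_exp_smul {A : Type*} [NormedRing A] [NormedAlgebra ℝ A] [CompleteSpace A]
    (M : A) : ContDiff ℝ 1 fun t : ℝ => NormedSpace.exp (t • M) := by
  have h := fun t : ℝ => hasDerivAt_exp_smul_const (𝕂 := ℝ) M t
  have hc : Continuous fun t : ℝ => NormedSpace.exp (t • M) :=
    continuous_iff_continuousAt.2 fun t => (h t).continuousAt
  rw [contDiff_one_iff_deriv]
  refine ⟨fun t => (h t).differentiableAt, ?_⟩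
  rw [funext fun t => (h t).deriv]
  fun_prop

/-- The factor `E` depends on `y₀` alone, so only `∂/∂y₀` differentiates it; commutation with the
generators lets it pass through the rest of `D`. -/
theorem cauchyRiemann_clm_apply {u : Pts n → V} {E : ℝ → V →L[ℝ] V} {E' : V →L[ℝ] V} {y : Pts n}
    (hu : DifferentiableAt ℝ u y) (hE : HasDerivAt E E' (y 0))
    (hcomm : ∀ (j : Fin n) (v : V),
      E (y 0) ((cliffGen j : Cliff n) • v) = (cliffGen j : Cliff n) • E (y 0) v) :
    cauchyRiemann (fun z => E (z 0) (u z)) y = E' (u y) + E (y 0) (cauchyRiemann u y) := by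
  have hp : HasFDerivAt (fun z : Pts n => z 0) (EuclideanSpace.proj 0 : Pts n →L[ℝ] ℝ) y :=
    (EuclideanSpace.proj 0 : Pts n →L[ℝ] ℝ).hasFDerivAt
  have h := (HasFDerivAt.comp y hE.hasFDerivAt hp).clm_apply hu.hasFDerivAt
  rw [cauchyRiemann_eq, cauchyRiemann_eq]
  simp only [Function.comp_def] at h
  rw [h.fderiv]
  simp [hcomm, map_sum, map_sub]
  abel

theorem cauchyRiemann_smul [SMulCommClass ℝ (Cliff n) V] {u : Pts n → V} {a : ℝ → ℝ} {a' : ℝ}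
    {y : Pts n} (hu : DifferentiableAt ℝ u y) (ha : HasDerivAt a a' (y 0)) :
    cauchyRiemann (fun z => a (z 0) • u z) y = a' • u y + a (y 0) • cauchyRiemann u y := by
  have h := cauchyRiemann_clm_apply (E := fun t => a t • ContinuousLinearMap.id ℝ V) hu
    (E' := a' • ContinuousLinearMap.id ℝ V) (ha.smul_const (ContinuousLinearMap.id ℝ V)) fun j v => by simp [smul_comm]
  simpa using h

theorem cauchyRiemann_add {u v : Pts n → V} {y : Pts n} (hu : DifferentiableAt ℝ u y)
    (hv : DifferentiableAt ℝ v y) :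
    cauchyRiemann (fun z => u z + v z) y = cauchyRiemann u y + cauchyRiemann v y := by
  simp only [cauchyRiemann_eq, fderiv_fun_add hu hv, add_apply, smul_add,
    Finset.sum_add_distrib]
  abel

theorem IsMassSolution.cauchyRiemann_eq {Ω : Set (Pts n)} {f Mf : Pts n → V}
    (h : IsMassSolution Ω f Mf) {y : Pts n} (hy : y ∈ Ω) : cauchyRiemann f y = Mf y := by
  rw [cauchyRiemann, h.equation y hy, add_sub_cancel_left]

end ProductRule

/-! ### Operators acting on values. -/

section MeanValue

variable {n : ℕ} {V : Type*} [NormedAddCommGroup V] [NormedSpace ℝ V] [FiniteDimensional ℝ V]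
  [Module (Cliff n) V] [IsScalarTower ℝ (Cliff n) V] {Ω : Set (Pts n)} {x : Pts n} {R : ℝ}

theorem closedBall_subset_closure (hR : 0 < R) (hball : Metric.ball x R ⊆ Ω) :
    Metric.closedBall x R ⊆ closure Ω := by
  rw [← closure_ball x hR.ne']
  exact closure_mono hball

/-- The mean value theorem for an operator acting on values. -/
theorem mean_value_massSolutions (hΩ : IsOpen Ω) (hR : 0 < R) (hball : Metric.ball x R ⊆ Ω)
    (M : V →L[ℝ] V)
    (hM : ∀ (j : Fin n) (v : V), M ((cliffGen j : Cliff n) • v) = (cliffGen j : Cliff n) • M v)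
    {f : Pts n → V} (hf : f ∈ massSolutions Ω M) :
    IntegrableOn (fun y : Pts n => NormedSpace.exp (-(y 0) • M) (f y)) (Metric.ball x R) ∧
      f x = NormedSpace.exp ((x 0) • M) ((meanConst n / R ^ (n + 1)) •
        ∫ y in Metric.ball x R, NormedSpace.exp (-(y 0) • M) (f y)) := by
  have : CompleteSpace V := FiniteDimensional.complete ℝ V
  set g : Pts n → V := fun y => NormedSpace.exp (-(y 0) • M) (f y) with hg
  have hE : ContDiff ℝ 1 fun t : ℝ => NormedSpace.exp (-t • M) :=
    (contDiff_exp_smul M).comp contDiff_neg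
  have hE0 : ContDiff ℝ 1 fun y : Pts n => NormedSpace.exp (-(y 0) • M) :=
    hE.comp (EuclideanSpace.proj 0 : Pts n →L[ℝ] ℝ).contDiff
  have hgc : ContinuousOn g (Metric.closedBall x R) :=
    hE0.continuous.continuousOn.clm_apply
      (hf.continuousOn_closure.mono (closedBall_subset_closure hR hball))
  have hgd : ContDiffOn ℝ 1 g (Metric.ball x R) :=
    hE0.contDiffOn.clm_apply (hf.contDiffOn.mono hball)
  have hcomm : ∀ (t : ℝ) (j : Fin n) (v : V), NormedSpace.exp (t • M) ((cliffGen j : Cliff n) • v)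
      = (cliffGen j : Cliff n) • NormedSpace.exp (t • M) v := by
    intro t j v
    have h1 : Commute M (cliffAction V (cliffGen j : Cliff n)) :=
      ContinuousLinearMap.ext fun v => hM j v
    have h2 : Commute (NormedSpace.exp (t • M)) (cliffAction V (cliffGen j : Cliff n)) :=
      (h1.smul_left t).exp_left
    exact DFunLike.congr_fun h2.eq v
  -- The derivative of the exponential contributes `-e^{-y₀M} M f`, cancelling `e^{-y₀M} D f =
  -- e^{-y₀M} M f`.
  have hD : ∀ y ∈ Metric.ball x R, cauchyRiemann g y = 0 := by
    intro y hy
    have hdE : HasDerivAt (fun t : ℝ => NormedSpace.exp (-t • M))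
        (-(NormedSpace.exp (-(y 0) • M) * M)) (y 0) := by
      simpa [Function.comp_def] using
        (hasDerivAt_exp_smul_const (𝕂 := ℝ) M (-(y 0))).scomp (y 0) (hasDerivAt_neg (y 0))
    have hdf : DifferentiableAt ℝ f y :=
      (hf.contDiffOn.differentiableOn one_ne_zero).differentiableAt (hΩ.mem_nhds (hball hy))
    rw [hg, cauchyRiemann_clm_apply hdf hdE fun j v => hcomm _ j v,
      IsMassSolution.cauchyRiemann_eq hf (hball hy)]
    simp
  refine ⟨integrableOn_ball_of_continuousOn_closedBall hgc, ?_⟩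
  obtain ⟨C, hC⟩ := exists_norm_mean_sub_le V x hR
  have h := hC g 0 hgc hgd fun y hy => by rw [hD y hy, norm_zero]
  rw [mul_zero, norm_le_zero_iff, sub_eq_zero] at h
  let _ : NormedAlgebra ℚ (V →L[ℝ] V) := .restrictScalars ℚ ℝ _
  rw [h, hg]
  beta_reduce
  rw [← mul_apply_eq_comp, ← NormedSpace.exp_add_of_commute
    (((Commute.refl M).smul_right _).smul_left _), ← add_smul, add_neg_cancel, zero_smul,
    NormedSpace.exp_zero, one_apply_eq_self]

end MeanValue

/-! ### Operators acting on a Banach space of functions. -/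

section FunctionSpace

variable {n : ℕ} {V : Type*} [NormedAddCommGroup V] [NormedSpace ℝ V] {Ω : Set (Pts n)}
  {X : Type*} [NormedAddCommGroup X] [NormedSpace ℝ X] {ι : X →ₗ[ℝ] (Pts n → V)}

/-- Uniform boundedness principle: each function is bounded on the compact set `K`, so the
evaluations at points of `K` are pointwise bounded, hence bounded in norm. Norm estimates in `X`
thereby become uniform estimates on `K`. -/
theorem IsFunctionSpace.exists_norm_le [CompleteSpace X] (hX : IsFunctionSpace Ω ι)
    {K : Set (Pts n)} (hK : IsCompact K) (hKΩ : K ⊆ closure Ω) :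
    ∃ C, 0 ≤ C ∧ ∀ u : X, ∀ y ∈ K, ‖ι u y‖ ≤ C * ‖u‖ := by
  let ev : K → X →L[ℝ] V := fun y =>
    ⟨(LinearMap.proj (y : Pts n)).comp ι, hX.continuous_eval y (hKΩ y.2)⟩
  obtain ⟨C, hC⟩ := banach_steinhaus (g := ev) fun u => by
    obtain ⟨B, hB⟩ := hK.exists_bound_of_continuousOn ((hX.continuousOn u).mono hKΩ)
    exact ⟨B, fun y => hB y y.2⟩
  refine ⟨max C 0, le_max_right _ _, fun u y hy => ?_⟩
  exact ((ev ⟨y, hy⟩).le_opNorm u).trans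
    (mul_le_mul_of_nonneg_right ((hC ⟨y, hy⟩).trans (le_max_left _ _)) (norm_nonneg u))

/-- The partial sums of the exponential series of `exp ((c - y₀) M) f`. -/
noncomputable def expPartialSum (ι : X →ₗ[ℝ] (Pts n → V)) (M : X →L[ℝ] X) (f : X) (c : ℝ)
    (N : ℕ) (y : Pts n) : V :=
  ∑ k ∈ Finset.range N, ((c - y 0) ^ k / (k.factorial : ℝ)) • ι ((M ^ k) f) y

theorem contDiffOn_expPartialSum {M : X →L[ℝ] X} {f : X}
    (h : ∀ k, ContDiffOn ℝ 1 (ι ((M ^ k) f)) Ω) (c : ℝ) (N : ℕ) :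
    ContDiffOn ℝ 1 (expPartialSum ι M f c N) Ω := by
  unfold expPartialSum
  refine ContDiffOn.sum fun k _ => ContDiffOn.smul (ContDiff.contDiffOn ?_) (h k)
  have : ContDiff ℝ 1 fun y : Pts n => y 0 := (EuclideanSpace.proj 0 : Pts n →L[ℝ] ℝ).contDiff
  fun_prop

theorem tendsto_expPartialSum [CompleteSpace X] (hX : IsFunctionSpace Ω ι) (M : X →L[ℝ] X)
    (f : X) (c : ℝ) {y : Pts n} (hy : y ∈ closure Ω) :
    Filter.Tendsto (fun N => expPartialSum ι M f c N y) Filter.atTop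
      (nhds (ι (NormedSpace.exp ((c - y 0) • M) f) y)) := by
  let ev : X →L[ℝ] V := ⟨(LinearMap.proj y).comp ι, hX.continuous_eval y hy⟩
  have h1 := NormedSpace.exp_series_hasSum_exp' (𝕂 := ℝ) ((c - y 0) • M)
  have h2 := (ev.comp (ContinuousLinearMap.apply ℝ X f)).hasSum h1
  refine h2.tendsto_sum_nat.congr fun N => Finset.sum_congr rfl fun k _ => ?_
  simp only [smul_pow, ContinuousLinearMap.comp_apply, ContinuousLinearMap.apply_apply,
    map_smul, smul_smul]
  rw [div_eq_inv_mul]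
  rfl

theorem norm_pow_clm_apply_le (M : X →L[ℝ] X) (f : X) (k : ℕ) :
    ‖(M ^ k) f‖ ≤ ‖M‖ ^ k * ‖f‖ := by
  induction k with
  | zero => simp
  | succ k ih =>
    rw [pow_succ', mul_apply_eq_comp, pow_succ', mul_assoc]
    exact (M.le_opNorm _).trans (mul_le_mul_of_nonneg_left ih (norm_nonneg _))

theorem norm_expTerm_le (M : X →L[ℝ] X) (f : X) {K : Set (Pts n)} {C R t : ℝ} (hC0 : 0 ≤ C)
    (hC : ∀ u : X, ∀ y ∈ K, ‖ι u y‖ ≤ C * ‖u‖) (k m : ℕ) {y : Pts n} (hy : y ∈ K)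
    (ht : |t| ≤ R) :
    ‖(t ^ k / (k.factorial : ℝ)) • ι ((M ^ m) f) y‖ ≤
      R ^ k / (k.factorial : ℝ) * (C * (‖M‖ ^ m * ‖f‖)) := by
  rw [norm_smul, norm_div, norm_pow, Real.norm_eq_abs, Real.norm_natCast]
  have h := (hC ((M ^ m) f) y hy).trans
    (mul_le_mul_of_nonneg_left (norm_pow_clm_apply_le M f m) hC0)
  have hR : 0 ≤ R := (abs_nonneg t).trans ht
  gcongr

theorem norm_expPartialSum_le (M : X →L[ℝ] X) (f : X) {K : Set (Pts n)} {C c R : ℝ} (hC0 : 0 ≤ C)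
    (hC : ∀ u : X, ∀ y ∈ K, ‖ι u y‖ ≤ C * ‖u‖) (N : ℕ) {y : Pts n} (hy : y ∈ K)
    (hyR : |c - y 0| ≤ R) :
    ‖expPartialSum ι M f c N y‖ ≤ Real.exp (R * ‖M‖) * (C * ‖f‖) := by
  have hR : 0 ≤ R := (abs_nonneg _).trans hyR
  calc ‖expPartialSum ι M f c N y‖
      ≤ ∑ k ∈ Finset.range N, R ^ k / (k.factorial : ℝ) * (C * (‖M‖ ^ k * ‖f‖)) :=
        (norm_sum_le _ _).trans
          (Finset.sum_le_sum fun k _ => norm_expTerm_le M f hC0 hC k k hy hyR)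
    _ = (∑ k ∈ Finset.range N, (R * ‖M‖) ^ k / (k.factorial : ℝ)) * (C * ‖f‖) := by
        rw [Finset.sum_mul]
        refine Finset.sum_congr rfl fun k _ => ?_
        rw [mul_pow]
        ring
    _ ≤ Real.exp (R * ‖M‖) * (C * ‖f‖) := by
        gcongr
        exact Real.sum_le_exp_of_nonneg (by positivity) N

theorem hasDerivAt_sub_pow_div_factorial (c t : ℝ) (k : ℕ) :
    HasDerivAt (fun t : ℝ => (c - t) ^ (k + 1) / ((k + 1).factorial : ℝ))
      (-((c - t) ^ k / (k.factorial : ℝ))) t := by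
  have h := (((hasDerivAt_id t).const_sub c).pow (k + 1)).div_const ((k + 1).factorial : ℝ)
  rw [Nat.add_sub_cancel, mul_neg_one, neg_div, Nat.factorial_succ, Nat.cast_mul,
    mul_div_mul_left _ _ (Nat.cast_ne_zero.2 k.succ_ne_zero), ← Nat.cast_mul,
    ← Nat.factorial_succ] at h
  exact h

variable [Module (Cliff n) V]

/-- The equation for `f` reads `D f = M f` with both sides in `X`; commutation propagates it to the
pairs `M^k f`, `M^(k+1) f`. -/
theorem CommutesWithCR.pow_apply {M : X →L[ℝ] X} (hM : CommutesWithCR Ω ι M) {f : X}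
    (hf : IsMassSolution Ω (ι f) (ι (M f))) (k : ℕ) :
    ContDiffOn ℝ 1 (ι ((M ^ k) f)) Ω ∧
      ∀ y ∈ Ω, cauchyRiemann (ι ((M ^ k) f)) y = ι ((M ^ (k + 1)) f) y := by
  induction k with
  | zero => exact ⟨by simpa using hf.contDiffOn, fun y hy => by simpa using hf.cauchyRiemann_eq hy⟩
  | succ k ih =>
    have h := hM _ _ ih.1 ih.2
    simpa only [← mul_apply_eq_comp, ← pow_succ'] using h

/-- Telescoping: differentiating the coefficient of each new term cancels what `D` left of the
preceding sum, and `D` acting on `M^(N+1) f` would leave the next remainder. -/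
theorem cauchyRiemann_expPartialSum [IsScalarTower ℝ (Cliff n) V] {M : X →L[ℝ] X} {f : X} (hΩ : IsOpen Ω)
    (h : ∀ k, ContDiffOn ℝ 1 (ι ((M ^ k) f)) Ω)
    (hD : ∀ k, ∀ y ∈ Ω, cauchyRiemann (ι ((M ^ k) f)) y = ι ((M ^ (k + 1)) f) y) (c : ℝ) (N : ℕ)
    {y : Pts n} (hy : y ∈ Ω) :
    cauchyRiemann (expPartialSum ι M f c (N + 1)) y =
      ((c - y 0) ^ N / (N.factorial : ℝ)) • ι ((M ^ (N + 1)) f) y := by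
  have hd : ∀ k, DifferentiableAt ℝ (ι ((M ^ k) f)) y := fun k =>
    ((h k).differentiableOn one_ne_zero).differentiableAt (hΩ.mem_nhds hy)
  induction N with
  | zero =>
    have : expPartialSum ι M f c 1 = ι ((M ^ 0) f) := by
      funext z
      simp [expPartialSum]
    rw [this, hD 0 y hy]
    simp
  | succ N ih =>
    have hsucc : expPartialSum ι M f c (N + 1 + 1) = fun z => expPartialSum ι M f c (N + 1) z +
        ((c - z 0) ^ (N + 1) / ((N + 1).factorial : ℝ)) • ι ((M ^ (N + 1)) f) z := by
      funext z
      rw [expPartialSum, Finset.sum_range_succ, expPartialSum]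
    have ha := hasDerivAt_sub_pow_div_factorial c (y 0) N
    have hds : DifferentiableAt ℝ (expPartialSum ι M f c (N + 1)) y :=
      ((contDiffOn_expPartialSum h c _).differentiableOn one_ne_zero).differentiableAt
        (hΩ.mem_nhds hy)
    have hp : DifferentiableAt ℝ (fun z : Pts n => z 0) y :=
      (EuclideanSpace.proj 0 : Pts n →L[ℝ] ℝ).differentiableAt
    have hdu : DifferentiableAt ℝ (fun z : Pts n =>
        ((c - z 0) ^ (N + 1) / ((N + 1).factorial : ℝ)) • ι ((M ^ (N + 1)) f) z) y :=
      DifferentiableAt.fun_smul (by fun_prop) (hd _)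
    rw [hsucc, cauchyRiemann_add hds hdu, ih,
      cauchyRiemann_smul (hd _) ha, hD _ y hy, neg_smul, add_neg_cancel_left]

variable [FiniteDimensional ℝ V] [IsScalarTower ℝ (Cliff n) V] {x : Pts n} {R : ℝ}

/-- The mean value theorem for an operator acting on a space of functions. -/
theorem mean_value_functionSpace [CompleteSpace X] (hΩ : IsOpen Ω) (hR : 0 < R)
    (hball : Metric.ball x R ⊆ Ω) (hX : IsFunctionSpace Ω ι) {M : X →L[ℝ] X}
    (hM : CommutesWithCR Ω ι M) {f : X} (hf : IsMassSolution Ω (ι f) (ι (M f))) :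
    IntegrableOn (fun y : Pts n => ι (NormedSpace.exp ((x 0 - y 0) • M) f) y)
      (Metric.ball x R) ∧
    ι f x = (meanConst n / R ^ (n + 1)) •
      ∫ y in Metric.ball x R, ι (NormedSpace.exp ((x 0 - y 0) • M) f) y := by
  have hcl := closedBall_subset_closure hR hball
  obtain ⟨B, hB0, hB⟩ := hX.exists_norm_le (isCompact_closedBall x R) hcl
  have hC1 := fun k => (hM.pow_apply hf k).1
  have hD := fun k => (hM.pow_apply hf k).2
  set g : ℕ → Pts n → V := fun N => expPartialSum ι M f (x 0) (N + 1) with hg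
  have hgd : ∀ N, ContDiffOn ℝ 1 (g N) (Metric.ball x R) := fun N =>
    (contDiffOn_expPartialSum hC1 (x 0) (N + 1)).mono hball
  have hgc : ∀ N, ContinuousOn (g N) (Metric.closedBall x R) := fun N =>
    continuousOn_finsetSum _ fun k _ => ContinuousOn.smul (by fun_prop)
      ((hX.continuousOn _).mono hcl)
  have hdist : ∀ y ∈ Metric.ball x R, |x 0 - y 0| ≤ R := fun y hy => by
    have h := PiLp.norm_apply_le (x - y) 0
    rw [← dist_eq_norm, dist_comm] at h
    exact h.trans (Metric.mem_ball.1 hy).le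
  have hlim : ∀ y ∈ closure Ω, Filter.Tendsto (fun N => g N y) Filter.atTop
      (nhds (ι (NormedSpace.exp ((x 0 - y 0) • M) f) y)) := fun y hy =>
    (tendsto_expPartialSum hX M f (x 0) hy).comp (Filter.tendsto_add_atTop_nat 1)
  have hmem : ∀ y ∈ Metric.ball x R, y ∈ closure Ω := fun y hy => subset_closure (hball hy)
  have hbound : ∀ N, ∀ y ∈ Metric.ball x R, ‖g N y‖ ≤ Real.exp (R * ‖M‖) * (B * ‖f‖) :=
    fun N y hy => norm_expPartialSum_le M f hB0 hB (N + 1) (Metric.ball_subset_closedBall hy)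
      (hdist y hy)
  have hmeas : ∀ N, AEStronglyMeasurable (g N) (volume.restrict (Metric.ball x R)) := fun N =>
    (integrableOn_ball_of_continuousOn_closedBall (hgc N)).aestronglyMeasurable
  have hlim_ae : ∀ᵐ y ∂volume.restrict (Metric.ball x R), Filter.Tendsto (fun N => g N y)
      Filter.atTop (nhds (ι (NormedSpace.exp ((x 0 - y 0) • M) f) y)) :=
    ae_restrict_of_forall_mem measurableSet_ball fun y hy => hlim y (hmem y hy)
  have hint := tendsto_integral_of_dominated_convergence
    (fun _ => Real.exp (R * ‖M‖) * (B * ‖f‖)) hmeas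
    (integrableOn_const measure_ball_lt_top.ne)
    (fun N => ae_restrict_of_forall_mem measurableSet_ball (hbound N)) hlim_ae
  refine ⟨Integrable.mono' (integrableOn_const (C := Real.exp (R * ‖M‖) * (B * ‖f‖))
      (measure_ball_lt_top (x := x) (r := R)).ne)
    (aestronglyMeasurable_of_tendsto_ae _ hmeas hlim_ae)
    (ae_restrict_of_forall_mem measurableSet_ball fun y hy =>
      le_of_tendsto' (hlim y (hmem y hy)).norm fun N => hbound N y hy), ?_⟩
  obtain ⟨C, hC⟩ := exists_norm_mean_sub_le V x hR
  -- Here `ε` bounds the single surviving term of `D (g N)`: the coefficient has degree `N`, while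
  -- the power of `M` is `N + 1`.
  have herr := fun N => hC (g N) (R ^ N / (N.factorial : ℝ) * (B * (‖M‖ ^ (N + 1) * ‖f‖)))
    (hgc N) (hgd N) fun y hy => by
      rw [hg, cauchyRiemann_expPartialSum hΩ hC1 hD (x 0) N (hball hy)]
      exact norm_expTerm_le M f hB0 hB N (N + 1) (Metric.ball_subset_closedBall hy) (hdist y hy)
  have hzero : Filter.Tendsto (fun N : ℕ =>
      C * (R ^ N / (N.factorial : ℝ) * (B * (‖M‖ ^ (N + 1) * ‖f‖)))) Filter.atTop (nhds 0) := by
    have h := (FloorSemiring.tendsto_pow_div_factorial_atTop (R * ‖M‖)).mul_const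
      (C * B * ‖M‖ * ‖f‖)
    rw [zero_mul] at h
    refine h.congr fun N => ?_
    rw [mul_pow, pow_succ]
    ring
  -- At the centre the exponent `x 0 - y 0` is zero, so the partial sums tend to `ι f x`.
  have hx := hlim x (hmem x (Metric.mem_ball_self hR))
  rw [sub_self, zero_smul, NormedSpace.exp_zero, one_apply_eq_self] at hx
  have h := le_of_tendsto_of_tendsto' ((hint.const_smul _).sub hx).norm hzero herr
  rw [norm_le_zero_iff, sub_eq_zero] at h
  exact h.symm

end FunctionSpace

theorem mainTheorem5 (n : ℕ) (V : Type*) [NormedAddCommGroup V] [NormedSpace ℝ V]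
    [FiniteDimensional ℝ V] [Module (Cliff n) V] [IsScalarTower ℝ (Cliff n) V]
    (Ω : Set (Pts n)) (hΩ : IsOpen Ω) (x : Pts n) (R : ℝ) (hR : 0 < R)
    (hball : Metric.ball x R ⊆ Ω) :
    -- `M` acts on values and commutes with the `e_j`
    (∀ M : V →L[ℝ] V, (∀ (j : Fin n) (v : V), M ((cliffGen j : Cliff n) • v) = cliffGen j • M v) →
      ∀ f ∈ massSolutions Ω M,
        IntegrableOn (fun y : Pts n => NormedSpace.exp (-(y 0) • M) (f y)) (Metric.ball x R) ∧
        f x = NormedSpace.exp ((x 0) • M) ((meanConst n / R ^ (n + 1)) •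
          ∫ y in Metric.ball x R, NormedSpace.exp (-(y 0) • M) (f y))) ∧
    -- `M` is a bounded operator on a Banach space of functions and commutes with `D`
    (∀ (X : Type*) [NormedAddCommGroup X] [NormedSpace ℝ X] [CompleteSpace X]
      (ι : X →ₗ[ℝ] (Pts n → V)) (M : X →L[ℝ] X),
      IsFunctionSpace Ω ι → CommutesWithCR Ω ι M →
      ∀ f : X, IsMassSolution Ω (ι f) (ι (M f)) →
        IntegrableOn (fun y : Pts n => ι (NormedSpace.exp ((x 0 - y 0) • M) f) y)
          (Metric.ball x R) ∧
        ι f x = (meanConst n / R ^ (n + 1)) •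
          ∫ y in Metric.ball x R, ι (NormedSpace.exp ((x 0 - y 0) • M) f) y) := by
  exact ⟨fun M hM f hf => mean_value_massSolutions hΩ hR hball M hM hf,
    fun X _ _ _ ι M hX hM f hf => mean_value_functionSpace hΩ hR hball hX hM hf⟩
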